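/- All Banach spaces are real. For Banach spaces $X,Y$ let $X\widehat\otimes_\pi Y$ be their projective tensor product, with the usual identification $(X\widehat\otimes_\pi Y)^*=L(X,Y^*)$, $T(x\otimes y)=T(x)(y)$, and let $K(X,Y^*)\subseteq L(X,Y^*)$ be the set of compact operators. The pair $(X,Y^*)$ has the compact approximation property (CAP) if $K(X,Y^*)$ is dense in $L(X,Y^*)$ for the topology of uniform convergence on compact subsets of $X$. A point $z$ of a subset $A$ of a Banach space $E$ is $w$-strongly exposed in $A$ if there is $f\in E^*$ such that $f(a)<f(z)$ for all $a\in A\setminus\{z\}$ and such that every sequence $(a_n)$ in $A$ with $f(a_n)\to f(z)$ converges weakly to $z$. Let $X$ and $Y$ be Banach spaces such that $K(X,Y^*)$ separates the points of $X\widehat\otimes_\pi Y$; this holds in particular if the pair $(X,Y^*)$ has the CAP. Let $C\subseteq X$ and $D\subseteq Y$ be bounded closed convex subsets, put $C\otimes D=\{x\otimes y: x\in C,\ y\in D\}$, and let $z$ be a $w$-strongly exposed point of the closed convex hull $\overline{\mathrm{conv}}(C\otimes D)\subseteq X\widehat\otimes_\pi Y$. Then $z=x\otimes y$ for some $x\in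 C$ and $y\in D$. Moreover, if $z\neq 0$, then for all $x\in C$ and $y\in D$ with $z=x\otimes y$, the points $x$ and $y$ are $w$-strongly exposed in $C$ and $D$, respectively. -/

import Mathlib

open Filter Topology
open scoped TensorProduct CompactConvergenceCLM

noncomputable section

/-- The algebraic tensor product of two real normed spaces, as a type of its own so that it can
carry the projective norm. -/
def AlgTensor (X Y : Type*) [NormedAddCommGroup X] [NormedSpace ℝ X]
    [NormedAddCommGroup Y] [NormedSpace ℝ Y] : Type _ :=
  X ⊗[ℝ] Y

namespace AlgTensor

variable {X Y : Type*} [NormedAddCommGroup X] [NormedSpace ℝ X]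
  [NormedAddCommGroup Y] [NormedSpace ℝ Y]

instance : AddCommGroup (AlgTensor X Y) := inferInstanceAs (AddCommGroup (X ⊗[ℝ] Y))

instance : Module ℝ (AlgTensor X Y) := inferInstanceAs (Module ℝ (X ⊗[ℝ] Y))

/-- The elementary tensor, bilinear in its two arguments. -/
def mk : X →ₗ[ℝ] Y →ₗ[ℝ] AlgTensor X Y := TensorProduct.mk ℝ X Y

/-- The element `∑ xᵢ ⊗ yᵢ` given by a finite list of pairs `(xᵢ, yᵢ)`. -/
def ofList (l : List (X × Y)) : AlgTensor X Y := (l.map fun p => mk p.1 p.2).sum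

/-- The number `∑ ‖xᵢ‖ ‖yᵢ‖` given by a finite list of pairs `(xᵢ, yᵢ)`. -/
def cost (l : List (X × Y)) : ℝ := (l.map fun p => ‖p.1‖ * ‖p.2‖).sum

/-- The projective norm `π(u) = inf {∑ ‖xᵢ‖ ‖yᵢ‖ : u = ∑ xᵢ ⊗ yᵢ}`. -/
def projNorm (u : AlgTensor X Y) : ℝ := sInf {r : ℝ | ∃ l : List (X × Y), ofList l = u ∧ cost l = r}

theorem cost_nonneg (l : List (X × Y)) : 0 ≤ cost l := by
  refine List.sum_nonneg fun a h => ?_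
  obtain ⟨p, -, rfl⟩ := List.mem_map.1 h
  positivity

theorem exists_ofList (u : AlgTensor X Y) : ∃ l, ofList l = u := by
  induction u using TensorProduct.induction_on with
  | zero => exact ⟨[], rfl⟩
  | tmul x y => exact ⟨[(x, y)], by simp [ofList]; rfl⟩
  | add a b ha hb =>
    obtain ⟨l, hl⟩ := ha
    obtain ⟨m, hm⟩ := hb
    refine ⟨l ++ m, ?_⟩
    rw [← hl, ← hm]
    simp only [ofList, List.map_append, List.sum_append]
    rfl

theorem projNorm_le (l : List (X × Y)) : projNorm (ofList l) ≤ cost l :=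
  csInf_le ⟨0, by rintro _ ⟨m, -, rfl⟩; exact cost_nonneg m⟩ ⟨l, rfl, rfl⟩

theorem le_projNorm {u : AlgTensor X Y} {r : ℝ} (h : ∀ l, ofList l = u → r ≤ cost l) :
    r ≤ projNorm u := by
  obtain ⟨l, hl⟩ := exists_ofList u
  refine le_csInf ⟨_, l, hl, rfl⟩ ?_
  rintro _ ⟨m, hm, rfl⟩
  exact h m hm

theorem projNorm_zero : projNorm (0 : AlgTensor X Y) = 0 :=
  le_antisymm (projNorm_le (X := X) (Y := Y) []) (le_projNorm fun l _ => cost_nonneg l)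

theorem projNorm_add_le (u v : AlgTensor X Y) : projNorm (u + v) ≤ projNorm u + projNorm v := by
  rw [← sub_le_iff_le_add]
  refine le_projNorm fun l hl => ?_
  rw [sub_le_comm]
  refine le_projNorm fun m hm => ?_
  have h := projNorm_le (l ++ m)
  have e : ofList (l ++ m) = u + v := by simp [ofList, ← hl, ← hm]
  have e' : cost (l ++ m) = cost l + cost m := by simp [cost]
  rw [e, e'] at h
  linarith

theorem projNorm_smul_le (a : ℝ) (u : AlgTensor X Y) : projNorm (a • u) ≤ ‖a‖ * projNorm u := by
  have key : ∀ l : List (X × Y), ofList l = u → projNorm (a • u) ≤ ‖a‖ * cost l := by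
    intro l hl
    have h := projNorm_le (l.map fun p => (a • p.1, p.2))
    have e : ofList (l.map fun p => (a • p.1, p.2)) = a • u := by
      simp [ofList, ← hl, List.smul_sum, Function.comp_def]
    have e' : cost (l.map fun p => (a • p.1, p.2)) = ‖a‖ * cost l := by
      simp [cost, norm_smul, Function.comp_def, mul_assoc, List.sum_map_mul_left]
    rwa [e, e'] at h
  rcases eq_or_ne a 0 with rfl | ha
  · simp [projNorm_zero]
  · have hpos : 0 < ‖a‖ := norm_pos_iff.2 ha
    rw [← div_le_iff₀' hpos]
    refine le_projNorm fun l hl => ?_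
    rw [div_le_iff₀' hpos]
    exact key l hl

instance : SeminormedAddCommGroup (AlgTensor X Y) :=
  AddGroupSeminorm.toSeminormedAddCommGroup
    (Seminorm.ofSMulLE (𝕜 := ℝ) projNorm projNorm_zero projNorm_add_le
      projNorm_smul_le).toAddGroupSeminorm

theorem norm_def (u : AlgTensor X Y) : ‖u‖ = projNorm u := rfl

instance : NormedSpace ℝ (AlgTensor X Y) := ⟨projNorm_smul_le⟩

/-- The linear functional `∑ xᵢ ⊗ yᵢ ↦ ∑ T xᵢ yᵢ` on the algebraic tensor product. -/
def liftLin (T : X →L[ℝ] StrongDual ℝ Y) : AlgTensor X Y →ₗ[ℝ] ℝ :=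
  TensorProduct.lift ((ContinuousLinearMap.coeLM ℝ).comp T.toLinearMap)

theorem liftLin_mk (T : X →L[ℝ] StrongDual ℝ Y) (x : X) (y : Y) :
    liftLin T (mk x y) = T x y :=
  TensorProduct.lift.tmul x y

theorem norm_liftLin_le (T : X →L[ℝ] StrongDual ℝ Y) (u : AlgTensor X Y) :
    ‖liftLin T u‖ ≤ ‖T‖ * ‖u‖ := by
  have key : ∀ l : List (X × Y), ‖liftLin T (ofList l)‖ ≤ ‖T‖ * cost l := by
    intro l
    induction l with
    | nil => simp [ofList, cost]
    | cons p l ih =>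
      have e : ofList (p :: l) = mk p.1 p.2 + ofList l := by simp [ofList]
      have e' : cost (p :: l) = ‖p.1‖ * ‖p.2‖ + cost l := by simp [cost]
      rw [e, e', map_add, liftLin_mk, mul_add, ← mul_assoc]
      exact (norm_add_le _ _).trans (add_le_add (T.le_opNorm₂ p.1 p.2) ih)
  rcases (norm_nonneg T).eq_or_lt with h0 | hpos
  · obtain ⟨l, rfl⟩ := exists_ofList u
    have h := key l
    rw [← h0] at h ⊢
    simpa using h
  · rw [← div_le_iff₀' hpos, norm_def]
    refine le_projNorm fun l hl => ?_
    rw [div_le_iff₀' hpos, ← hl]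
    exact key l

end AlgTensor

/-- The projective tensor product `X ⊗̂_π Y`: the completion of the algebraic tensor product in
the projective norm. -/
abbrev ProjTensor (X Y : Type*) [NormedAddCommGroup X] [NormedSpace ℝ X]
    [NormedAddCommGroup Y] [NormedSpace ℝ Y] : Type _ :=
  UniformSpace.Completion (AlgTensor X Y)

namespace ProjTensor

variable {X Y : Type*} [NormedAddCommGroup X] [NormedSpace ℝ X]
  [NormedAddCommGroup Y] [NormedSpace ℝ Y]

/-- The elementary tensor `x ⊗ y` in the projective tensor product. -/
def tmul (x : X) (y : Y) : ProjTensor X Y := ((AlgTensor.mk x y : AlgTensor X Y) : ProjTensor X Y)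

/-- The set `C ⊗ D = {x ⊗ y : x ∈ C, y ∈ D}`. -/
def tmulSet (C : Set X) (D : Set Y) : Set (ProjTensor X Y) := Set.image2 tmul C D

/-- The action of a bounded operator `T : X → Y*` on the projective tensor product, through the
identification `(X ⊗̂_π Y)* = L(X, Y*)`: the continuous linear functional whose value at `x ⊗ y`
is `T x y`. -/
def functional (T : X →L[ℝ] StrongDual ℝ Y) : StrongDual ℝ (ProjTensor X Y) :=
  ((AlgTensor.liftLin T).mkContinuous ‖T‖ (AlgTensor.norm_liftLin_le T)).extend
    UniformSpace.Completion.toComplL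

theorem functional_tmul (T : X →L[ℝ] StrongDual ℝ Y) (x : X) (y : Y) :
    functional T (tmul x y) = T x y :=
  (ContinuousLinearMap.extend_eq _ (e := UniformSpace.Completion.toComplL)
    UniformSpace.Completion.denseRange_coe
    (UniformSpace.Completion.isUniformInducing_coe _) _).trans (AlgTensor.liftLin_mk T x y)

end ProjTensor

/-- `K(X, Y*)` separates the points of `X ⊗̂_π Y`. -/
def CompactOperatorsSeparate (X Y : Type*) [NormedAddCommGroup X] [NormedSpace ℝ X]
    [NormedAddCommGroup Y] [NormedSpace ℝ Y] : Prop :=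
  ∀ u v : ProjTensor X Y, u ≠ v → ∃ T : X →L[ℝ] StrongDual ℝ Y,
    IsCompactOperator T ∧ ProjTensor.functional T u ≠ ProjTensor.functional T v

/-- The pair `(X, Z)` has the compact approximation property: the compact operators are dense in
`L(X, Z)` for the topology of uniform convergence on compact subsets of `X`. -/
def HasPairCAP (X Z : Type*) [NormedAddCommGroup X] [NormedSpace ℝ X]
    [NormedAddCommGroup Z] [NormedSpace ℝ Z] : Prop :=
  Dense {T : X →L_c[ℝ] Z | IsCompactOperator T}

/-- `x` is a weak-strongly exposed point of `C`: it lies in `C` and some continuous linear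
functional `f` exposes `x` in `C` and is such that every sequence `u` in `C` with
`f (u n) → f x` converges weakly to `x`. -/
def IsWeakStronglyExposed {E : Type*} [NormedAddCommGroup E] [NormedSpace ℝ E]
    (C : Set E) (x : E) : Prop :=
  x ∈ C ∧ ∃ f : StrongDual ℝ E, (∀ y ∈ C, y ≠ x → f y < f x) ∧
    ∀ u : ℕ → E, (∀ n, u n ∈ C) → Tendsto (fun n => f (u n)) atTop (𝓝 (f x)) →
      Tendsto (fun n => toWeakSpace ℝ E (u n)) atTop (𝓝 (toWeakSpace ℝ E x))

end

/-! The exposing functional is maximal at `z`, so it is approximated on `C ⊗ D`, and strong exposure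
makes `z` a weak limit of tensors `u n ⊗ v n`. Pass to an ultrafilter. If some `f` has `f (u i) → a
≠ 0`, applying `f ⊗ id` shows that `v i` converges weakly; symmetrically for `u i`. Otherwise one of
the factors is weakly null. A compact `T` makes `T (u i)` converge in norm, so `T (u i) (v i)` tends
to `T x y` (to `0` in the weakly null cases), and separation by compact operators gives `z = x ⊗ y`
(`CompactOperatorsSeparate.mem_tmulSet`).

For `z = x ⊗ y ≠ 0`, exposure pulls back along `c ↦ c ⊗ y` and `d ↦ x ⊗ d`
(`IsWeakStronglyExposed.of_map`).

The CAP implies separation because each tensor acts on operators continuously for compact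
convergence (`exists_compact_bound`). -/

/-! ### Estimates on the algebraic tensor product -/

namespace AlgTensor

variable {X Y Z : Type*} [NormedAddCommGroup X] [NormedSpace ℝ X]
  [NormedAddCommGroup Y] [NormedSpace ℝ Y] [NormedAddCommGroup Z] [NormedSpace ℝ Z]

theorem ofList_cons (p : X × Y) (l : List (X × Y)) :
    ofList (p :: l) = mk p.1 p.2 + ofList l := by
  simp [ofList]

theorem cost_cons (p : X × Y) (l : List (X × Y)) :
    cost (p :: l) = ‖p.1‖ * ‖p.2‖ + cost l := by
  simp [cost]

theorem norm_mk_le (x : X) (y : Y) : ‖mk x y‖ ≤ ‖x‖ * ‖y‖ := by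
  simpa [ofList, cost, norm_def] using projNorm_le [(x, y)]

theorem exists_ofList_cost_lt {u : AlgTensor X Y} {M : ℝ} (h : ‖u‖ < M) :
    ∃ l, ofList l = u ∧ cost l < M := by
  by_contra! H
  exact absurd (le_projNorm H) (not_le.2 h)

/-- The linear map on the algebraic tensor product induced by a bounded bilinear map. -/
noncomputable def liftBilin (B : X →L[ℝ] Y →L[ℝ] Z) : AlgTensor X Y →ₗ[ℝ] Z :=
  TensorProduct.lift ((ContinuousLinearMap.coeLM ℝ).comp B.toLinearMap)

theorem liftBilin_mk (B : X →L[ℝ] Y →L[ℝ] Z) (x : X) (y : Y) :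
    liftBilin B (mk x y) = B x y :=
  TensorProduct.lift.tmul x y

theorem norm_liftBilin_ofList_le (B : X →L[ℝ] Y →L[ℝ] Z) {c : ℝ} (l : List (X × Y))
    (h : ∀ p ∈ l, ‖B p.1‖ ≤ c * ‖p.1‖) : ‖liftBilin B (ofList l)‖ ≤ c * cost l := by
  induction l with
  | nil => simp [ofList, cost]
  | cons p l ih =>
    rw [ofList_cons, cost_cons, map_add, liftBilin_mk, mul_add, ← mul_assoc]
    refine (norm_add_le _ _).trans (add_le_add ?_ (ih fun q hq => h q (List.mem_cons_of_mem p hq)))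
    exact (B p.1).le_of_opNorm_le (h p List.mem_cons_self) p.2

theorem norm_liftBilin_le (B : X →L[ℝ] Y →L[ℝ] Z) (u : AlgTensor X Y) :
    ‖liftBilin B u‖ ≤ ‖B‖ * ‖u‖ := by
  refine le_of_forall_pos_le_add fun ε hε => ?_
  have hB : 0 < ‖B‖ + 1 := by positivity
  obtain ⟨l, rfl, hl⟩ := exists_ofList_cost_lt (lt_add_of_pos_right ‖u‖ (div_pos hε hB))
  refine (norm_liftBilin_ofList_le B l fun p _ => B.le_opNorm p.1).trans ?_
  have h1 := mul_le_mul_of_nonneg_left hl.le (norm_nonneg B)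
  have h2 : ‖B‖ * (ε / (‖B‖ + 1)) ≤ ε := by
    rw [← mul_div_assoc, div_le_iff₀ hB]
    nlinarith
  rw [mul_add] at h1
  linarith

/-- A tensor of norm less than `M` is controlled by finitely many vectors of norm at most `ε`. -/
theorem exists_finite_bound {u : AlgTensor X Y} {M ε : ℝ} (hu : ‖u‖ < M) (hε : 0 < ε) :
    ∃ F : Set X, F.Finite ∧ (∀ x ∈ F, ‖x‖ ≤ ε) ∧
      ∀ (T : X →L[ℝ] StrongDual ℝ Y) (r : ℝ), 0 ≤ r → (∀ x ∈ F, ‖T x‖ ≤ r) →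
        ‖liftLin T u‖ ≤ M / ε * r := by
  obtain ⟨l, rfl, hl⟩ := exists_ofList_cost_lt hu
  -- Rescaling each nonzero first factor to norm `ε` costs a factor `‖p.1‖ / ε`, whence the bound `M
  -- / ε * r`.
  refine ⟨(fun p : X × Y => (ε / ‖p.1‖) • p.1) '' {p | p ∈ l}, l.finite_toSet.image _, ?_, ?_⟩
  · rintro _ ⟨p, -, rfl⟩
    rcases eq_or_ne p.1 0 with h | h
    · simp [h, hε.le]
    · have := norm_pos_iff.2 h
      simp only [norm_smul, norm_div, norm_norm, Real.norm_of_nonneg hε.le]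
      rw [div_mul_cancel₀ _ this.ne']
  · intro T r hr hT
    have key : ∀ p ∈ l, ‖T p.1‖ ≤ r / ε * ‖p.1‖ := by
      intro p hp
      rcases eq_or_ne p.1 0 with h | h
      · simp [h]
      · have hpos := norm_pos_iff.2 h
        have := hT _ ⟨p, hp, rfl⟩
        simp only [map_smul, norm_smul, norm_div, norm_norm, Real.norm_of_nonneg hε.le] at this
        rw [div_mul_eq_mul_div, le_div_iff₀ hε]
        rw [div_mul_eq_mul_div, div_le_iff₀ hpos] at this
        linarith
    refine (norm_liftBilin_ofList_le T l key).trans ?_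
    rw [div_mul_eq_mul_div, div_mul_eq_mul_div, mul_comm r]
    gcongr

end AlgTensor

/-! ### Functionals and operators on the completion -/

namespace ProjTensor

variable {X Y Z : Type*} [NormedAddCommGroup X] [NormedSpace ℝ X]
  [NormedAddCommGroup Y] [NormedSpace ℝ Y] [NormedAddCommGroup Z] [NormedSpace ℝ Z]

/-- The continuous linear map on the projective tensor product induced by a bounded bilinear
map. -/
noncomputable def lift (B : X →L[ℝ] Y →L[ℝ] Z) [CompleteSpace Z] : ProjTensor X Y →L[ℝ] Z :=
  ((AlgTensor.liftBilin B).mkContinuous ‖B‖ (AlgTensor.norm_liftBilin_le B)).extend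
    UniformSpace.Completion.toComplL

theorem lift_tmul [CompleteSpace Z] (B : X →L[ℝ] Y →L[ℝ] Z) (x : X) (y : Y) :
    lift B (tmul x y) = B x y :=
  (ContinuousLinearMap.extend_eq _ (e := UniformSpace.Completion.toComplL)
    UniformSpace.Completion.denseRange_coe
    (UniformSpace.Completion.isUniformInducing_coe _) _).trans (AlgTensor.liftBilin_mk B x y)

theorem functional_coe (T : X →L[ℝ] StrongDual ℝ Y) (u : AlgTensor X Y) :
    functional T (u : ProjTensor X Y) = AlgTensor.liftLin T u :=
  ContinuousLinearMap.extend_eq _ (e := UniformSpace.Completion.toComplL)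
    UniformSpace.Completion.denseRange_coe
    (UniformSpace.Completion.isUniformInducing_coe _) _

variable (X Y) in
/-- The elementary tensor as a bounded bilinear map. -/
noncomputable def tmulL : X →L[ℝ] Y →L[ℝ] ProjTensor X Y :=
  LinearMap.mkContinuous₂
    (AlgTensor.mk.compr₂ (UniformSpace.Completion.toComplL (𝕜 := ℝ)).toLinearMap) 1 fun x y => by
      rw [one_mul]
      exact (UniformSpace.Completion.norm_coe _).trans_le (AlgTensor.norm_mk_le x y)

theorem tmulL_apply (x : X) (y : Y) : tmulL X Y x y = tmul x y :=
  rfl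

theorem tmul_zero (x : X) : tmul x (0 : Y) = 0 :=
  map_zero (tmulL X Y x)

theorem zero_tmul (y : Y) : tmul (0 : X) y = 0 :=
  (tmulL X Y).map_zero₂ y

theorem clm_ext {φ ψ : StrongDual ℝ (ProjTensor X Y)}
    (h : ∀ x y, φ (tmul x y) = ψ (tmul x y)) : φ = ψ := by
  ext u
  refine UniformSpace.Completion.induction_on u (isClosed_eq φ.continuous ψ.continuous) fun a => ?_
  obtain ⟨l, rfl⟩ := AlgTensor.exists_ofList a
  induction l with
  | nil => simp [AlgTensor.ofList, UniformSpace.Completion.coe_zero]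
  | cons p l ih =>
    rw [AlgTensor.ofList_cons, UniformSpace.Completion.coe_add, map_add, map_add, ih]
    exact congrArg (· + _) (h p.1 p.2)

/-- The bounded operator `X → Y*` that represents a functional on the projective tensor
product. -/
noncomputable def toOperator (φ : StrongDual ℝ (ProjTensor X Y)) : X →L[ℝ] StrongDual ℝ Y :=
  φ.postcomp Y ∘L tmulL X Y

theorem toOperator_apply (φ : StrongDual ℝ (ProjTensor X Y)) (x : X) (y : Y) :
    toOperator φ x y = φ (tmul x y) :=
  rfl

theorem functional_toOperator (φ : StrongDual ℝ (ProjTensor X Y)) :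
    functional (toOperator φ) = φ :=
  clm_ext fun x y => by rw [functional_tmul, toOperator_apply]

/-- The action of bounded operators on an element of the projective tensor product is bounded
by their supremum on a suitable compact set. -/
theorem exists_compact_bound (w : ProjTensor X Y) :
    ∃ K : Set X, IsCompact K ∧ ∃ M : ℝ, ∀ (T : X →L[ℝ] StrongDual ℝ Y) (r : ℝ), 0 ≤ r →
      (∀ x ∈ K, ‖T x‖ ≤ r) → ‖functional T w‖ ≤ M * r := by
  have hdense : ∀ k : ℕ, ∃ a : AlgTensor X Y, dist w (a : ProjTensor X Y) < (1 / 4) ^ k := fun k =>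
    (UniformSpace.Completion.denseRange_coe (α := AlgTensor X Y)).exists_dist_lt w (by positivity)
  choose a ha using hdense
  -- Telescoping: the partial sums of `d` are the approximants `a n` of `w`.
  obtain ⟨d, hd0, hd⟩ : ∃ d : ℕ → AlgTensor X Y, d 0 = a 0 ∧ ∀ k, d (k + 1) = a (k + 1) - a k :=
    ⟨fun | 0 => a 0 | k + 1 => a (k + 1) - a k, rfl, fun _ => rfl⟩
  -- The 5 comes from `(1/4)^k + (1/4)^(k+1) = 5 * (1/4)^(k+1)`.
  obtain ⟨B, hB⟩ : ∃ B, B = ‖a 0‖ + 5 := ⟨_, rfl⟩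
  have hdB : ∀ k, ‖d k‖ < B * (1 / 4) ^ k := by
    rintro (_ | k)
    · simp [hd0, hB]
    · have h : ‖d (k + 1)‖ = dist (a (k + 1) : ProjTensor X Y) (a k) := by
        rw [hd, dist_eq_norm, ← UniformSpace.Completion.coe_sub, UniformSpace.Completion.norm_coe]
      have h1 := dist_triangle_left (a (k + 1) : ProjTensor X Y) (a k) w
      have h2 := ha k
      have h3 := ha (k + 1)
      have h4 : (0 : ℝ) < (1 / 4) ^ k := by positivity
      have h5 := norm_nonneg (a 0)
      rw [pow_succ] at h3 ⊢
      nlinarith [mul_nonneg h5 h4.le]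
  -- Radii `(1/2)^k` tend to zero, which gives compactness, while the weights `B * (1/4)^k / (1/2)^k
  -- = B * (1/2)^k` stay summable, with sum `2 * B`.
  choose F hFfin hFle hF using fun k =>
    AlgTensor.exists_finite_bound (hdB k) (show (0 : ℝ) < (1 / 2) ^ k by positivity)
  refine ⟨insert 0 (⋃ k, F k), ?_, B * 2, fun T r hr hT => ?_⟩
  · rw [isCompact_iff_ultrafilter_le_nhds]
    intro U hU
    rw [le_principal_iff, Ultrafilter.mem_coe] at hU
    -- An ultrafilter either lives on finitely many of the finite sets `F k`, or avoids every
    -- initial union and hence tends to `0`.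
    by_cases h : ∃ n, (⋃ k ∈ Set.Iio n, F k) ∈ U
    · obtain ⟨n, hn⟩ := h
      have hfin : (⋃ k ∈ Set.Iio n, F k).Finite := (Set.finite_Iio n).biUnion fun k _ => hFfin k
      obtain ⟨x, hx, hUx⟩ := hfin.isCompact.ultrafilter_le_nhds U (le_principal_iff.2 hn)
      refine ⟨x, Set.mem_insert_of_mem _ ?_, hUx⟩
      obtain ⟨k, -, hk⟩ := Set.mem_iUnion₂.1 hx
      exact Set.mem_iUnion.2 ⟨k, hk⟩
    · push Not at h
      refine ⟨0, Set.mem_insert _ _, (Metric.nhds_basis_ball.ge_iff).2 fun ε hε => ?_⟩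
      obtain ⟨n, hn⟩ := exists_pow_lt_of_lt_one hε (show (1 / 2 : ℝ) < 1 by norm_num)
      change _ ∈ U
      filter_upwards [hU, Ultrafilter.compl_mem_iff_notMem.2 (h n)] with x hx hxn
      rw [mem_ball_zero_iff]
      rcases hx with rfl | hx
      · simpa using hε
      · obtain ⟨k, hk⟩ := Set.mem_iUnion.1 hx
        have hnk : n ≤ k := by
          by_contra! hkn
          exact hxn (Set.mem_iUnion₂.2 ⟨k, hkn, hk⟩)
        refine ((hFle k x hk).trans ?_).trans_lt hn
        exact pow_le_pow_of_le_one (by norm_num) (by norm_num) hnk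
  · have hdT : ∀ k, ‖AlgTensor.liftLin T (d k)‖ ≤ B * (1 / 2) ^ k * r := by
      intro k
      have h := hF k T r hr fun x hx => hT x (Set.mem_insert_of_mem _ (Set.mem_iUnion.2 ⟨k, hx⟩))
      rwa [mul_div_assoc, ← div_pow, show (1 / 4 / (1 / 2) : ℝ) = 1 / 2 by norm_num] at h
    have hsum : ∀ n, ‖AlgTensor.liftLin T (a n)‖ ≤ B * r * (2 - (1 / 2) ^ n) := by
      intro n
      induction n with
      | zero =>
        have := hdT 0
        rw [hd0] at this
        norm_num at this ⊢
        exact this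
      | succ n ih =>
        have h := hdT (n + 1)
        have e : a (n + 1) = a n + d (n + 1) := by rw [hd]; abel
        rw [e, map_add]
        refine (norm_add_le _ _).trans ((add_le_add ih h).trans_eq ?_)
        ring
    have hB0 : 0 ≤ B * r := mul_nonneg (by rw [hB]; positivity) hr
    have hlim : Tendsto (fun n => (a n : ProjTensor X Y)) atTop (𝓝 w) := by
      rw [tendsto_iff_dist_tendsto_zero]
      refine squeeze_zero (fun _ => dist_nonneg) (fun n => ?_)
        (tendsto_pow_atTop_nhds_zero_of_lt_one (by norm_num : (0 : ℝ) ≤ 1 / 4) (by norm_num))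
      rw [dist_comm]
      exact (ha n).le
    refine le_of_tendsto (((functional T).continuous.tendsto w).comp hlim).norm
      (Eventually.of_forall fun n => ?_)
    rw [Function.comp_apply, functional_coe]
    refine (hsum n).trans ?_
    have : (0 : ℝ) ≤ (1 / 2) ^ n := by positivity
    nlinarith

end ProjTensor

/-! ### The CAP implies separation -/

open ProjTensor

theorem HasPairCAP.compactOperatorsSeparate {X Y : Type*} [NormedAddCommGroup X] [NormedSpace ℝ X]
    [NormedAddCommGroup Y] [NormedSpace ℝ Y] (h : HasPairCAP X (StrongDual ℝ Y)) :
    CompactOperatorsSeparate X Y := by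
  intro u v huv
  obtain ⟨φ, hφ⟩ := SeparatingDual.exists_ne_zero (R := ℝ) (sub_ne_zero.2 huv)
  obtain ⟨K, hK, M, hM⟩ := exists_compact_bound (u - v)
  obtain ⟨T, hT⟩ : ∃ T : X →L_c[ℝ] StrongDual ℝ Y, T = toOperator φ := ⟨_, rfl⟩
  have hne := mem_closure_iff_nhdsWithin_neBot.1 (h T)
  have hlim := (UniformConvergenceCLM.tendsto_iff_tendstoUniformlyOn _ _ {S : Set X | IsCompact S}).1
    (tendsto_id'.2 (nhdsWithin_le_nhds (a := T) (s := {T | IsCompactOperator T}))) K hK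
  -- With this `r`, `M * r` is at most half of `‖φ (u - v)‖`, whatever the sign of `M`. A compact
  -- `S` within `r` of `φ` on `K` therefore cannot vanish at `u - v`.
  obtain ⟨r, hr⟩ : ∃ r, r = ‖φ (u - v)‖ / (2 * (|M| + 1)) := ⟨_, rfl⟩
  have hr0 : 0 < r := by
    have := norm_pos_iff.2 hφ
    rw [hr]
    positivity
  obtain ⟨S, hSK, hS⟩ := ((Metric.tendstoUniformlyOn_iff.1 hlim r hr0).and
    self_mem_nhdsWithin).exists
  obtain ⟨S', hS'⟩ : ∃ S' : X →L[ℝ] StrongDual ℝ Y, S' = S := ⟨_, rfl⟩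
  refine ⟨S', hS' ▸ hS, fun heq => ?_⟩
  have hS0 : functional S' (u - v) = 0 := by rw [map_sub, heq, sub_self]
  have hb := hM (toOperator φ - S') r hr0.le fun x hx => by
    have := (hSK x hx).le
    rw [hT, dist_eq_norm] at this
    rw [hS']
    exact this
  have hsub : functional (toOperator φ - S') = functional (toOperator φ) - functional S' :=
    clm_ext fun x y => by
      simp only [functional_tmul, sub_apply]
  rw [hsub, sub_apply, hS0, sub_zero, functional_toOperator] at hb
  have h1 : M * r ≤ (|M| + 1) * r := by
    have := le_abs_self M
    nlinarith
  have h2 : (|M| + 1) * r = ‖φ (u - v)‖ / 2 := by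
    rw [hr]
    field_simp
  have := norm_pos_iff.2 hφ
  linarith

/-! ### Weak limits and compact operators along ultrafilters -/

theorem tendsto_toWeakSpace_iff {E ι : Type*} [NormedAddCommGroup E] [NormedSpace ℝ E]
    {l : Filter ι} {u : ι → E} {x : E} :
    Tendsto (fun i => toWeakSpace ℝ E (u i)) l (𝓝 (toWeakSpace ℝ E x)) ↔
      ∀ f : StrongDual ℝ E, Tendsto (fun i => f (u i)) l (𝓝 (f x)) :=
  WeakBilin.tendsto_iff_forall_eval_tendsto (topDualPairing ℝ E).flip
    fun _ _ h => (SeparatingDual.eq_iff_forall_dual_eq (R := ℝ)).2 (DFunLike.congr_fun h)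

/-- A closed convex set contains the weak limits of its families. -/
theorem IsClosed.mem_of_forall_dual_tendsto {E ι : Type*} [NormedAddCommGroup E] [NormedSpace ℝ E]
    {l : Filter ι} [l.NeBot] {C : Set E} (hc : IsClosed C) (hC : Convex ℝ C) {u : ι → E} {x : E}
    (hu : ∀ i, u i ∈ C) (h : ∀ f : StrongDual ℝ E, Tendsto (fun i => f (u i)) l (𝓝 (f x))) :
    x ∈ C := by
  by_contra hx
  obtain ⟨f, s, hs, hsx⟩ := geometric_hahn_banach_closed_point hC hc hx
  exact absurd (le_of_tendsto (h f) (Eventually.of_forall fun i => (hs _ (hu i)).le))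
    (not_le.2 hsx)

theorem IsCompact.exists_tendsto_ultrafilter {Z ι : Type*} [TopologicalSpace Z] {K : Set Z}
    (hK : IsCompact K) (U : Ultrafilter ι) {u : ι → Z} (hu : ∀ i, u i ∈ K) :
    ∃ a, Tendsto u U (𝓝 a) := by
  obtain ⟨a, -, ha⟩ := hK.ultrafilter_le_nhds (U.map u)
    (tendsto_principal.2 (Eventually.of_forall hu))
  exact ⟨a, ha⟩

theorem IsCompactOperator.exists_tendsto_ultrafilter {E F ι : Type*} [NormedAddCommGroup E]
    [NormedSpace ℝ E] [NormedAddCommGroup F] [NormedSpace ℝ F] {T : E →L[ℝ] F}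
    (hT : IsCompactOperator T) (U : Ultrafilter ι) {C : Set E} (hC : Bornology.IsBounded C)
    {u : ι → E} (hu : ∀ i, u i ∈ C) : ∃ a, Tendsto (fun i => T (u i)) U (𝓝 a) := by
  obtain ⟨K, hK, hCK⟩ := hT.image_subset_compact_of_bounded (f := T.toLinearMap) hC
  exact hK.exists_tendsto_ultrafilter U fun i => hCK ⟨u i, hu i, rfl⟩

/-- Along an ultrafilter, a bounded family either tends weakly to zero, or has a nonzero limit
under some functional. -/
theorem dual_tendsto_zero_or_exists_ne_zero {E ι : Type*} [NormedAddCommGroup E] [NormedSpace ℝ E]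
    (U : Ultrafilter ι) {C : Set E} (hC : Bornology.IsBounded C) {u : ι → E} (hu : ∀ i, u i ∈ C) :
    (∀ f : StrongDual ℝ E, Tendsto (fun i => f (u i)) U (𝓝 (f 0))) ∨
      ∃ (f : StrongDual ℝ E) (a : ℝ), a ≠ 0 ∧ Tendsto (fun i => f (u i)) U (𝓝 a) := by
  by_cases h : ∃ (f : StrongDual ℝ E) (a : ℝ), a ≠ 0 ∧ Tendsto (fun i => f (u i)) U (𝓝 a)
  · exact Or.inr h
  · push Not at h
    refine Or.inl fun f => ?_
    have hf : IsCompactOperator f := isCompactOperator_of_locallyCompactSpace_dom f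
    obtain ⟨a, ha⟩ := hf.exists_tendsto_ultrafilter U hC hu
    have ha0 : a = 0 := by
      by_contra h0
      exact h f a h0 ha
    rwa [map_zero, ← ha0]

/-- The action of a compact operator on `u i ⊗ v i`, where `T (u i) → η` and `v` is bounded. -/
theorem tendsto_apply_of_tendsto_bounded {E F ι : Type*} [NormedAddCommGroup E] [NormedSpace ℝ E]
    [NormedAddCommGroup F] [NormedSpace ℝ F] {l : Filter ι} {T : E →L[ℝ] StrongDual ℝ F}
    {u : ι → E} {v : ι → F} {D : Set F} {η : StrongDual ℝ F} {a : ℝ} (hD : Bornology.IsBounded D)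
    (hv : ∀ i, v i ∈ D) (hη : Tendsto (fun i => T (u i)) l (𝓝 η))
    (ha : Tendsto (fun i => η (v i)) l (𝓝 a)) :
    Tendsto (fun i => T (u i) (v i)) l (𝓝 a) := by
  obtain ⟨R, hR⟩ := hD.exists_norm_le
  have h0 : Tendsto (fun i => (T (u i) - η) (v i)) l (𝓝 0) := by
    have h1 : Tendsto (fun i => ‖T (u i) - η‖ * R) l (𝓝 0) := by
      simpa using (tendsto_iff_norm_sub_tendsto_zero.1 hη).mul_const R
    exact squeeze_zero_norm (fun i => (T (u i) - η).le_opNorm_of_le (hR _ (hv i))) h1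
  simpa using h0.add ha

/-! ### Weak limits of elementary tensors -/

section

variable {X Y : Type*} [NormedAddCommGroup X] [NormedSpace ℝ X]
  [NormedAddCommGroup Y] [NormedSpace ℝ Y] {ι : Type*} {l : Filter ι} {u : ι → X} {v : ι → Y}
  {z : ProjTensor X Y}

/-- The slice map `f ⊗ id` sends `u i ⊗ v i` to `f (u i) • v i`. Dividing by `f (u i) → a ≠ 0`
leaves the weak limit `a⁻¹ • (f ⊗ id) z` of `v i`. -/
theorem exists_dual_tendsto_right [CompleteSpace Y]
    (h : ∀ φ : StrongDual ℝ (ProjTensor X Y), Tendsto (fun i => φ (tmul (u i) (v i))) l (𝓝 (φ z)))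
    {f : StrongDual ℝ X} {a : ℝ} (ha : a ≠ 0) (hf : Tendsto (fun i => f (u i)) l (𝓝 a)) :
    ∃ y : Y, ∀ g : StrongDual ℝ Y, Tendsto (fun i => g (v i)) l (𝓝 (g y)) := by
  refine ⟨a⁻¹ • lift (f.smulRight (ContinuousLinearMap.id ℝ Y)) z, fun g => ?_⟩
  have h1 := h (g ∘L lift (f.smulRight (ContinuousLinearMap.id ℝ Y)))
  simp only [ContinuousLinearMap.comp_apply, lift_tmul, ContinuousLinearMap.smulRight_apply,
    smul_apply, ContinuousLinearMap.id_apply, map_smul, smul_eq_mul] at h1 ⊢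
  refine ((hf.inv₀ ha).mul h1).congr' ?_
  filter_upwards [hf.eventually_ne ha] with i hi
  rw [inv_mul_cancel_left₀ hi]

theorem exists_dual_tendsto_left [CompleteSpace X]
    (h : ∀ φ : StrongDual ℝ (ProjTensor X Y), Tendsto (fun i => φ (tmul (u i) (v i))) l (𝓝 (φ z)))
    {g : StrongDual ℝ Y} {a : ℝ} (ha : a ≠ 0) (hg : Tendsto (fun i => g (v i)) l (𝓝 a)) :
    ∃ x : X, ∀ f : StrongDual ℝ X, Tendsto (fun i => f (u i)) l (𝓝 (f x)) := by
  refine ⟨a⁻¹ • lift (g.smulRight (ContinuousLinearMap.id ℝ X)).flip z, fun f => ?_⟩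
  have h1 := h (f ∘L lift (g.smulRight (ContinuousLinearMap.id ℝ X)).flip)
  simp only [ContinuousLinearMap.comp_apply, lift_tmul, ContinuousLinearMap.flip_apply,
    ContinuousLinearMap.smulRight_apply,
    smul_apply, ContinuousLinearMap.id_apply, map_smul, smul_eq_mul] at h1 ⊢
  refine ((hg.inv₀ ha).mul h1).congr' ?_
  filter_upwards [hg.eventually_ne ha] with i hi
  rw [inv_mul_cancel_left₀ hi]

/-- If the compact operators separate the points of `X ⊗̂_π Y`, then for bounded closed convex
sets `C` and `D` a weak limit along an ultrafilter of elements of `C ⊗ D` lies in `C ⊗ D`. -/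
theorem CompactOperatorsSeparate.mem_tmulSet [CompleteSpace X] [CompleteSpace Y]
    (hsep : CompactOperatorsSeparate X Y) {C : Set X} {D : Set Y} (hC : Convex ℝ C)
    (hCb : Bornology.IsBounded C) (hCc : IsClosed C) (hD : Convex ℝ D)
    (hDb : Bornology.IsBounded D) (hDc : IsClosed D) (U : Ultrafilter ι) (hu : ∀ i, u i ∈ C)
    (hv : ∀ i, v i ∈ D)
    (h : ∀ φ : StrongDual ℝ (ProjTensor X Y), Tendsto (fun i => φ (tmul (u i) (v i))) U (𝓝 (φ z))) :
    ∃ x ∈ C, ∃ y ∈ D, z = tmul x y := by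
  have key : ∀ x y, (∀ T : X →L[ℝ] StrongDual ℝ Y, IsCompactOperator T →
      Tendsto (fun i => T (u i) (v i)) U (𝓝 (T x y))) → z = tmul x y := by
    intro x y hxy
    by_contra hne
    obtain ⟨T, hT, hTne⟩ := hsep _ _ hne
    refine hTne ?_
    rw [functional_tmul]
    refine tendsto_nhds_unique ((h (functional T)).congr fun i => functional_tmul T _ _) (hxy T hT)
  have weak_left : ∀ x, (∀ f : StrongDual ℝ X, Tendsto (fun i => f (u i)) U (𝓝 (f x))) →
      ∀ T : X →L[ℝ] StrongDual ℝ Y, IsCompactOperator T →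
        Tendsto (fun i => T (u i)) U (𝓝 (T x)) := by
    intro x hx T hT
    obtain ⟨η, hη⟩ := hT.exists_tendsto_ultrafilter U hCb hu
    -- Compactness supplies a norm limit `η`; weak convergence of `u` identifies it, since `T · y'`
    -- is a functional on `X`.
    suffices e : T x = η by rwa [e]
    refine ContinuousLinearMap.ext fun y' => ?_
    refine tendsto_nhds_unique (hx (T.flip y')) ?_
    exact ((ContinuousLinearMap.apply ℝ ℝ y').continuous.tendsto η).comp hη
  -- If one factor is weakly null then `z = 0`, and any point of the other set serves as second
  -- factor; `i₀` provides one.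
  obtain ⟨i₀⟩ := U.neBot.nonempty
  rcases dual_tendsto_zero_or_exists_ne_zero U hCb hu with hu0 | ⟨f, a, ha, hf⟩
  · refine ⟨0, hCc.mem_of_forall_dual_tendsto hC hu hu0, v i₀, hv i₀, key _ _ fun T hT => ?_⟩
    refine tendsto_apply_of_tendsto_bounded hDb hv (weak_left 0 hu0 T hT) ?_
    simp
  rcases dual_tendsto_zero_or_exists_ne_zero U hDb hv with hv0 | ⟨g, b, hb, hg⟩
  · refine ⟨u i₀, hu i₀, 0, hDc.mem_of_forall_dual_tendsto hD hv hv0, key _ _ fun T hT => ?_⟩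
    obtain ⟨η, hη⟩ := hT.exists_tendsto_ultrafilter U hCb hu
    refine tendsto_apply_of_tendsto_bounded hDb hv hη ?_
    simpa using hv0 η
  obtain ⟨y, hy⟩ := exists_dual_tendsto_right h ha hf
  obtain ⟨x, hx⟩ := exists_dual_tendsto_left h hb hg
  exact ⟨x, hCc.mem_of_forall_dual_tendsto hC hu hx, y, hDc.mem_of_forall_dual_tendsto hD hv hy,
    key _ _ fun T hT => tendsto_apply_of_tendsto_bounded hDb hv (weak_left x hx T hT) (hy _)⟩

end

/-! ### Exposed points and the main theorem -/

/-- A functional attains values on `S` arbitrarily close to its value at any point of the closed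
convex hull of `S` at which it is maximal. -/
theorem exists_seq_tendsto_of_mem_closedConvexHull {E : Type*} [NormedAddCommGroup E]
    [NormedSpace ℝ E] {S : Set E} {z : E} (hz : z ∈ closedConvexHull ℝ S) (f : StrongDual ℝ E)
    (hf : ∀ y ∈ S, f y ≤ f z) :
    ∃ s : ℕ → E, (∀ n, s n ∈ S) ∧ Tendsto (fun n => f (s n)) atTop (𝓝 (f z)) := by
  have hex : ∀ n : ℕ, ∃ s ∈ S, f z - 1 / ((n : ℝ) + 1) < f s := by
    intro n
    by_contra! H
    -- Otherwise a closed half-space contains `S`, hence its closed convex hull, but not `z`.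
    have := closedConvexHull_min (𝕜 := ℝ) (t := {x | f x ≤ f z - 1 / ((n : ℝ) + 1)}) H
      (convex_halfSpace_le f.toLinearMap.isLinear _) (isClosed_le f.continuous continuous_const) hz
    have hpos : (0 : ℝ) < 1 / ((n : ℝ) + 1) := by positivity
    rw [Set.mem_ofPred_eq] at this
    linarith
  choose s hs hfs using hex
  refine ⟨s, hs, tendsto_of_tendsto_of_tendsto_of_le_of_le ?_ tendsto_const_nhds
    (fun n => (hfs n).le) fun n => hf _ (hs n)⟩
  simpa using tendsto_one_div_add_atTop_nhds_zero_nat.const_sub (f z)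

/-- Weak-strong exposure passes to preimages under a continuous linear map `A` through
which every functional factors. -/
theorem IsWeakStronglyExposed.of_map {E F : Type*} [NormedAddCommGroup E] [NormedSpace ℝ E]
    [NormedAddCommGroup F] [NormedSpace ℝ F] {S : Set F} {C : Set E} {x : E} {A : E →L[ℝ] F}
    (hA : ∀ f : StrongDual ℝ E, ∃ φ : StrongDual ℝ F, ∀ c, φ (A c) = f c)
    (h : IsWeakStronglyExposed S (A x)) (hCS : Set.MapsTo A C S) (hx : x ∈ C) :
    IsWeakStronglyExposed C x := by
  obtain ⟨-, f, hf, hfs⟩ := h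
  refine ⟨hx, f ∘L A, fun c hc hcx => hf _ (hCS hc) fun heq => hcx ?_, fun s hs hlim => ?_⟩
  -- `A` is injective because functionals on `E` factor through it and separate points.
  · rw [SeparatingDual.eq_iff_forall_dual_eq (R := ℝ)]
    intro g
    obtain ⟨φ, hφ⟩ := hA g
    exact (hφ c).symm.trans ((congrArg φ heq).trans (hφ x))
  · rw [tendsto_toWeakSpace_iff]
    intro g
    obtain ⟨φ, hφ⟩ := hA g
    simpa only [hφ] using
      tendsto_toWeakSpace_iff.1 (hfs (fun n => A (s n)) (fun n => hCS (hs n)) hlim) φ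

theorem corollary3p1 (X Y : Type*) [NormedAddCommGroup X] [NormedSpace ℝ X] [CompleteSpace X]
    [NormedAddCommGroup Y] [NormedSpace ℝ Y] [CompleteSpace Y] :
    (HasPairCAP X (StrongDual ℝ Y) → CompactOperatorsSeparate X Y) ∧
    (CompactOperatorsSeparate X Y →
      ∀ (C : Set X) (D : Set Y),
        Convex ℝ C → Bornology.IsBounded C → IsClosed C →
        Convex ℝ D → Bornology.IsBounded D → IsClosed D →
        ∀ z : ProjTensor X Y,
          IsWeakStronglyExposed (closedConvexHull ℝ (ProjTensor.tmulSet C D)) z →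
          (∃ x ∈ C, ∃ y ∈ D, z = ProjTensor.tmul x y) ∧
          (z ≠ 0 → ∀ x ∈ C, ∀ y ∈ D, z = ProjTensor.tmul x y →
            IsWeakStronglyExposed C x ∧ IsWeakStronglyExposed D y)) := by
  refine ⟨HasPairCAP.compactOperatorsSeparate,
    fun hsep C D hC hCb hCc hD hDb hDc z hz => ⟨?_, fun hz0 x hx y hy hxy => ?_⟩⟩
  · obtain ⟨hmem, f, hf, hfs⟩ := hz
    have hle : ∀ s ∈ tmulSet C D, f s ≤ f z := fun s hs => by
      rcases eq_or_ne s z with rfl | hne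
      · exact le_rfl
      · exact (hf s (subset_closedConvexHull hs) hne).le
    obtain ⟨s, hs, hlim⟩ := exists_seq_tendsto_of_mem_closedConvexHull hmem f hle
    have hweak := tendsto_toWeakSpace_iff.1
      (hfs s (fun n => subset_closedConvexHull (hs n)) hlim)
    choose u hu v hv huv using hs
    refine hsep.mem_tmulSet hC hCb hCc hD hDb hDc (hyperfilter ℕ) hu hv fun φ => ?_
    simpa only [huv] using (hweak φ).mono_left Nat.hyperfilter_le_atTop
  · have hmaps : ∀ c ∈ C, ∀ d ∈ D, tmul c d ∈ closedConvexHull ℝ (tmulSet C D) :=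
      fun c hc d hd => subset_closedConvexHull ⟨c, hc, d, hd, rfl⟩
    have hx0 : x ≠ 0 := by
      rintro rfl
      exact hz0 (hxy.trans (zero_tmul y))
    have hy0 : y ≠ 0 := by
      rintro rfl
      exact hz0 (hxy.trans (tmul_zero x))
    rw [hxy] at hz
    -- Since `g₀ y = 1`, the functional `f ⊗ g₀` takes the value `f c` at `c ⊗ y`; `f₀` plays the
    -- same role for the other factor.
    obtain ⟨f₀, hf₀⟩ := SeparatingDual.exists_eq_one (R := ℝ) hx0
    obtain ⟨g₀, hg₀⟩ := SeparatingDual.exists_eq_one (R := ℝ) hy0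
    constructor
    · refine IsWeakStronglyExposed.of_map (A := (tmulL X Y).flip y)
        (fun f => ⟨functional (f.smulRight g₀), fun c => ?_⟩) hz (fun c hc => hmaps c hc y hy) hx
      rw [ContinuousLinearMap.flip_apply, tmulL_apply, functional_tmul]
      simp [hg₀]
    · refine IsWeakStronglyExposed.of_map (A := tmulL X Y x)
        (fun g => ⟨functional (f₀.smulRight g), fun d => ?_⟩) hz (fun d hd => hmaps x hx d hd) hy
      rw [tmulL_apply, functional_tmul]
      simp [hf₀]
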